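/- **Notation.** Let $\gamma$ be Euler's constant, $\zeta$ the Riemann zeta function, $\psi=\Gamma'/\Gamma$ the digamma function, $H_n=\sum_{k=1}^n 1/k$, and let ${r\brack j}$ be the unsigned Stirling numbers of the first kind, so that $x(x+1)\cdots(x+r-1)=\sum_{j=0}^r{r\brack j}x^j$. For integers $r\ge 0$, $n\ge 1$ the hyperharmonic numbers are $h_n^{(0)}=1/n$ and $h_n^{(r)}=\sum_{k=1}^n h_k^{(r-1)}$ for $r\ge1$; their analytic extension to real $x>0$ is $h_x^{(0)}=1/x$ and, for $r\ge 1$, $$h_x^{(r)}=\frac{\Gamma(x+r)}{x\,\Gamma(x)\,\Gamma(r)}\bigl(\psi(x+r)-\psi(r)\bigr).$$ Put $$\gamma_{h^{(r)}}=\lim_{n\to\infty}\left(\sum_{k=1}^n\frac{h_k^{(r)}}{k^r}-\int_1^n\frac{h_x^{(r)}}{x^r}\,dx\right).$$ **Theorem.** Let $r$ be a non-negative integer. The limit defining $\gamma_{h^{(r)}}$ exists, and the improper integrals and the series below converge absolutely. If $r\ge1$, then $$\begin{aligned}\Gamma(r)\,\gamma_{h^{(r)}}&=\tfrac12\gamma^2+\tfrac12\zeta(2)-\tfrac12+\int_0^\infty\frac{\ln(1+t^2)}{(e^{2\pi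 t}-1)\,t}\,dt-(\psi(r)+\gamma)\gamma+r!-r+\sum_{j=1}^{r-1}\frac{H_j}{j}\\&\quad+\sum_{j=1}^{r-1}{r\brack j}\left(E(r,j)+\frac{\psi(r)}{r-j}-\frac{r}{r+1-j}-H_{r-1}\,\zeta(r+1-j)\right),\end{aligned}$$ where, for $1\le j\le r-1$, $$E(r,j)=\sum_{k=r}^\infty\frac{H_k}{(k+1-r)^{r+1-j}}-\int_1^\infty\frac{\psi(x+1)}{x^{r+1-j}}\,dx,$$ and empty sums are zero. For $r=0$, where $\Gamma$ and $\psi$ have poles, the formula holds after division by $\Gamma(r)$ as a limit: $$\gamma_{h^{(0)}}=\lim_{\substack{s\to0\\ s\ne0}}\frac1{\Gamma(s)}\left(\tfrac12\gamma^2+\tfrac12\zeta(2)-\tfrac12+\int_0^\infty\frac{\ln(1+t^2)}{(e^{2\pi t}-1)\,t}\,dt-(\psi(s)+\gamma)\gamma+\Gamma(s+1)-s\right)=\gamma .$$ -/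

import Mathlib

open Filter Topology MeasureTheory

noncomputable section

/-- The digamma function `ψ` at a real argument (Mathlib's complex digamma function there). -/
def psi (x : ℝ) : ℝ := (Complex.digamma (x : ℂ)).re

/-- At real arguments `ψ` is the logarithmic derivative of the real Gamma function. -/
theorem psi_eq_logDeriv (x : ℝ) : psi x = logDeriv Real.Gamma x := by
  unfold psi
  rw [Complex.digamma_def, logDeriv_apply, logDeriv_apply]
  by_cases hx : ∀ m : ℕ, x ≠ -m
  · have hc : ∀ m : ℕ, (x : ℂ) ≠ -m := fun m h => hx m (by exact_mod_cast h)
    have hd := (Complex.differentiableAt_Gamma (x : ℂ) hc).hasDerivAt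
    have hr : HasDerivAt Real.Gamma (deriv Complex.Gamma (x : ℂ)).re x := hd.real_of_complex
    rw [hr.deriv, Complex.Gamma_ofReal, Complex.div_ofReal_re]
  · push Not at hx
    obtain ⟨m, rfl⟩ := hx
    have h : Real.Gamma (-(m : ℝ)) = 0 := Real.Gamma_neg_nat_eq_zero m
    rw [Complex.Gamma_ofReal, h]
    simp

/-- The generalized rising factorial `Γ(x + r) / Γ(x)`. -/
def risingPow (x r : ℝ) : ℝ := Real.Gamma (x + r) / Real.Gamma x

/-- The hyperharmonic number `h_n^{(r)}`: `h_n^{(0)} = 1 / n` and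
`h_n^{(r + 1)} = ∑_{k = 1}^{n} h_k^{(r)}`. -/
def hyperharmonic : ℕ → ℕ → ℝ
  | 0, n => 1 / (n : ℝ)
  | r + 1, n => ∑ k ∈ Finset.Icc 1 n, hyperharmonic r k

/-- The analytic extension `h_x^{(r)}` of the hyperharmonic numbers to a real index `x > 0`,
with `h_x^{(0)} = 1 / x`. -/
def hyperharmonicExt (r : ℕ) (x : ℝ) : ℝ :=
  if r = 0 then 1 / x
  else risingPow x r / (x * Real.Gamma r) * (psi (x + r) - psi r)

/-- The sequence `y_n(r) = ∑_{k = 1}^{n} h_k^{(r)} / k^r - ∫_1^n h_x^{(r)} / x^r dx`. -/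
def ySeq (r n : ℕ) : ℝ :=
  (∑ k ∈ Finset.Icc 1 n, hyperharmonic r k / (k : ℝ) ^ r)
    - ∫ x in (1 : ℝ)..(n : ℝ), hyperharmonicExt r x / x ^ r

/-- The constant `γ_{h^{(r)}} = lim_{n → ∞} y_n(r)`. -/
def gammaH (r : ℕ) : ℝ := limUnder atTop (ySeq r)

/-- The harmonic number `H_n`, as a real number. -/
def harm (n : ℕ) : ℝ := (harmonic n : ℝ)

/-- The terms of the series `∑_{k ≥ r} H_k / (k + 1 - r)^{r + 1 - j}`, with `k = r + i`. -/
def eTerm (r j i : ℕ) : ℝ := harm (r + i) / ((i : ℝ) + 1) ^ (r + 1 - j)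

/-- The integrand `ψ(x + 1) / x^{r + 1 - j}`. -/
def eIntegrand (r j : ℕ) (x : ℝ) : ℝ := psi (x + 1) / x ^ (r + 1 - j)

/-- `E(r, j) = ∑_{k ≥ r} H_k / (k + 1 - r)^{r + 1 - j} - ∫_1^∞ ψ(x + 1) / x^{r + 1 - j} dx`. -/
def eConst (r j : ℕ) : ℝ := (∑' i : ℕ, eTerm r j i) - ∫ x in Set.Ioi (1 : ℝ), eIntegrand r j x

/-- The Riemann zeta function at a natural number `n ≥ 2`, as a real number. -/
def zetaNat (n : ℕ) : ℝ := (riemannZeta (n : ℂ)).re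

/-- The integrand `ln(1 + t²) / ((e^{2πt} - 1) t)`. -/
def logIntegrand (t : ℝ) : ℝ :=
  Real.log (1 + t ^ 2) / ((Real.exp (2 * Real.pi * t) - 1) * t)

end

/-! For `r ≥ 1`, multiplying by `Γ(r)` turns the summand and the integrand into `L(k)(H_{k+r-1} -
H_{r-1})` and `L(x)(ψ(x+r) - ψ(r))`, where `L(x) = x(x+1)⋯(x+r-1)/x^{r+1}` is a combination of the
powers `x^{-(r+1-j)}` with Stirling coefficients (`stirlingLaurent_eq`). Write `ψ(x+r) = ψ(x+1) +
∑_{0<i<r} 1/(x+i)`. Since `L(x) ∑_{0<i<r} 1/(x+i) = L'(x) + r L(x)/x`, the rational part integrates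
in closed form; it yields `r!`, `-r` and the terms `-r/(r+1-j)`. The rest splits over `j`
(`Gamma_mul_ySeq`).

For `j < r` the exponent is at least 2, so sum and integral converge separately and give `E(r,j)`,
the zeta value and `ψ(r)/(r-j)`. For `j = r` the exponent is 1 and both diverge like `ln²n/2`. The
sum is explicit in `H_n` and `∑ 1/k²`; for the integral of `ψ(x+1)/x`, Binet's formula `ψ(x+1) = ln
x + 1/(2x) - ∫_0^∞ 2t/((t²+x²)(e^{2πt}-1)) dt` and Fubini isolate the logarithmic integral
(`tendsto_integral_psi_add_one_div`). The divergent terms cancel in `tendsto_stirlingPart_self`.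

For `r = 0` the sequence is `H_n - ln n`, and the limit in `s` comes from `ψ(s)/Γ(s) → -1`. -/

/-! ### Digamma function: recurrence, logarithmic bounds, continuity. -/

theorem Real.differentiableAt_Gamma_of_pos {x : ℝ} (hx : 0 < x) :
    DifferentiableAt ℝ Real.Gamma x :=
  Real.differentiableAt_Gamma fun m => ((neg_nonpos.mpr m.cast_nonneg).trans_lt hx).ne'

theorem hasDerivAt_log_Gamma {x : ℝ} (hx : 0 < x) :
    HasDerivAt (Real.log ∘ Real.Gamma) (psi x) x := by
  rw [psi_eq_logDeriv, logDeriv_apply]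
  exact (Real.differentiableAt_Gamma_of_pos hx).hasDerivAt.log (Real.Gamma_pos_of_pos hx).ne'

/-- Negative non-integers are admitted because the case `r = 0` approaches the pole at `0` from both
sides. -/
theorem psi_add_one {x : ℝ} (hx : ∀ m : ℕ, x ≠ -m) : psi (x + 1) = psi x + 1 / x := by
  have := Complex.digamma_apply_add_one (x : ℂ) fun m h => hx m (by exact_mod_cast h)
  unfold psi
  push_cast
  rw [this, Complex.add_re, ← Complex.ofReal_inv, Complex.ofReal_re, one_div]

theorem psi_add_one_of_pos {x : ℝ} (hx : 0 < x) : psi (x + 1) = psi x + 1 / x :=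
  psi_add_one fun m => ((neg_nonpos.mpr m.cast_nonneg).trans_lt hx).ne'

theorem psi_one : psi 1 = -Real.eulerMascheroniConstant := by
  simp [psi, Complex.digamma_one]

theorem psi_nat_add_one (n : ℕ) : psi ((n : ℝ) + 1) = harm n - Real.eulerMascheroniConstant := by
  induction n with
  | zero => simp [psi_one, harm]
  | succ n ih =>
    rw [psi_add_one_of_pos (by positivity)]
    push_cast
    rw [ih]
    simp [harm]
    ring

/-- `log Γ` is convex, so this chord slope lies between the tangent slopes `ψ(x)` and `ψ(x+1)`; the
next two bounds follow. -/
theorem slope_log_Gamma {x : ℝ} (hx : 0 < x) :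
    slope (Real.log ∘ Real.Gamma) x (x + 1) = Real.log x := by
  rw [slope_def_field, Function.comp_apply, Function.comp_apply, Real.Gamma_add_one hx.ne',
    Real.log_mul hx.ne' (Real.Gamma_pos_of_pos hx).ne']
  ring

theorem log_le_psi_add_one {x : ℝ} (hx : 0 < x) : Real.log x ≤ psi (x + 1) := by
  rw [← slope_log_Gamma hx]
  exact Real.convexOn_log_Gamma.slope_le_of_hasDerivAt (Set.mem_Ioi.2 hx)
    (Set.mem_Ioi.2 (by linarith)) (by linarith) (hasDerivAt_log_Gamma (by linarith))

theorem psi_add_one_le {x : ℝ} (hx : 0 < x) : psi (x + 1) ≤ Real.log x + 1 / x := by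
  rw [← slope_log_Gamma hx, psi_add_one_of_pos hx]
  gcongr
  exact Real.convexOn_log_Gamma.le_slope_of_hasDerivAt (Set.mem_Ioi.2 hx)
    (Set.mem_Ioi.2 (by linarith)) (by linarith) (hasDerivAt_log_Gamma hx)

/-- `Γ` is holomorphic off its poles, a closed set of integers, so its derivative is holomorphic
there too, and `Γ` has no zeros there. -/
theorem continuousAt_psi {x : ℝ} (hx : ∀ m : ℕ, x ≠ -m) : ContinuousAt psi x := by
  have hc : ∀ m : ℕ, (x : ℂ) ≠ -m := fun m h => hx m (by exact_mod_cast h)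
  have hU : IsOpen {z : ℂ | ∀ m : ℕ, z ≠ -m} := by
    have : {z : ℂ | ∀ m : ℕ, z ≠ -m} = (Set.range fun m : ℕ => -(m : ℂ))ᶜ := by
      ext z; simp [eq_comm]
    rw [this, isOpen_compl_iff]
    have h := Complex.isClosedEmbedding_intCast.isClosedMap (Set.range fun m : ℕ => -(m : ℤ))
      (isClosed_discrete _)
    rw [← Set.range_comp] at h
    convert h using 2
    ext m
    simp
  have hd : DifferentiableOn ℂ Complex.Gamma {z : ℂ | ∀ m : ℕ, z ≠ -m} := fun z hz =>
    (Complex.differentiableAt_Gamma z hz).differentiableWithinAt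
  have h1 : ContinuousAt (deriv Complex.Gamma) (x : ℂ) :=
    ((hd.deriv hU).differentiableAt (hU.mem_nhds hc)).continuousAt
  have h2 : ContinuousAt Complex.Gamma (x : ℂ) := (Complex.differentiableAt_Gamma _ hc).continuousAt
  have h3 : ContinuousAt Complex.digamma (x : ℂ) := h1.div h2 (Complex.Gamma_ne_zero hc)
  exact Complex.continuous_re.continuousAt.comp (h3.comp Complex.continuous_ofReal.continuousAt)

theorem continuousOn_psi : ContinuousOn psi (Set.Ioi 0) := fun _ hx =>
  (continuousAt_psi fun m =>
    ((neg_nonpos.mpr m.cast_nonneg).trans_lt (Set.mem_Ioi.1 hx)).ne').continuousWithinAt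

theorem continuousOn_psi_add_one : ContinuousOn (fun x => psi (x + 1)) (Set.Ioi 0) :=
  continuousOn_psi.comp (by fun_prop) fun x hx => by
    simp only [Set.mem_Ioi] at hx ⊢; linarith

/-! ### Binet's second formula for the digamma function. -/

theorem integrableOn_mul_exp_neg_mul {a : ℝ} (ha : 0 < a) :
    IntegrableOn (fun t : ℝ => t * Real.exp (-a * t)) (Set.Ioi 0) ∧
      ∫ t in Set.Ioi (0 : ℝ), t * Real.exp (-a * t) = 1 / a ^ 2 := by
  have h := Real.integral_rpow_mul_exp_neg_mul_Ioi (a := 2) two_pos ha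
  have h2 : ∫ t in Set.Ioi (0 : ℝ), t * Real.exp (-a * t) = 1 / a ^ 2 := by
    norm_num [Real.Gamma_two] at h
    simpa [neg_mul] using h
  refine ⟨?_, h2⟩
  -- A non-integrable function has integral `0` by convention, which contradicts the positive value.
  by_contra hn
  rw [integral_undef hn] at h2
  have : 0 < 1 / a ^ 2 := by positivity
  linarith

/-- Imaginary part of the integral of `e^{ct}` with `c = -a + bi`. -/
theorem integrableOn_sin_mul_exp_neg_mul {a : ℝ} (ha : 0 < a) (b : ℝ) :
    IntegrableOn (fun t : ℝ => Real.sin (b * t) * Real.exp (-a * t)) (Set.Ioi 0) ∧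
      ∫ t in Set.Ioi (0 : ℝ), Real.sin (b * t) * Real.exp (-a * t) = b / (a ^ 2 + b ^ 2) := by
  set c : ℂ := -a + b * Complex.I with hc
  have hre : c.re < 0 := by simp [hc, ha]
  have hi := integrableOn_exp_mul_complex_Ioi hre 0
  have heq : (fun t : ℝ => Real.sin (b * t) * Real.exp (-a * t)) =
      fun t : ℝ => (Complex.exp (c * t)).im := by
    funext t
    have : c * t = ((-a * t : ℝ) : ℂ) + ((b * t : ℝ) : ℂ) * Complex.I := by
      simp [hc]; ring
    rw [this, Complex.exp_add_mul_I, ← Complex.ofReal_exp, Complex.im_ofReal_mul, ← Complex.ofReal_cos, ← Complex.ofReal_sin]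
    simp only [Complex.add_im, Complex.mul_im, Complex.ofReal_re, Complex.ofReal_im, Complex.I_re,
      Complex.I_im]
    ring
  rw [heq]
  refine ⟨hi.im, ?_⟩
  have h1 := integral_im (𝕜 := ℂ) hi
  simp only [RCLike.im_eq_complex_im] at h1
  rw [h1, integral_exp_mul_complex_Ioi hre]
  simp only [Complex.ofReal_zero, mul_zero, Complex.exp_zero]
  rw [Complex.div_im]
  simp [hc, Complex.normSq_apply]
  ring_nf

theorem abs_sin_mul_le (b : ℝ) {t : ℝ} (hb : 0 ≤ b) (ht : 0 ≤ t) : |Real.sin (b * t)| ≤ b * t :=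
  (Real.abs_sin_le_abs).trans_eq (abs_of_nonneg (mul_nonneg hb ht))

theorem exp_two_pi_mul_sub_one_pos {t : ℝ} (ht : 0 < t) : 0 < Real.exp (2 * Real.pi * t) - 1 := by
  have : 1 < Real.exp (2 * Real.pi * t) := Real.one_lt_exp_iff.2 (by positivity)
  linarith

/-- The majorant `e^{-πt}/(2π)` comes from `πt ≤ sinh(πt)`, since `e^{2πt} - 1 = 2 e^{πt} sinh(πt)`.
-/
theorem integrableOn_div_exp_sub_one :
    IntegrableOn (fun t : ℝ => t / (Real.exp (2 * Real.pi * t) - 1)) (Set.Ioi 0) := by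
  have h := (exp_neg_integrableOn_Ioi 0 Real.pi_pos).const_mul (1 / (2 * Real.pi))
  refine Integrable.mono' h (Measurable.aestronglyMeasurable (by fun_prop)) ?_
  refine ae_restrict_of_forall_mem measurableSet_Ioi fun t ht => ?_
  have ht : 0 < t := ht
  have hp := exp_two_pi_mul_sub_one_pos ht
  rw [Real.norm_of_nonneg (by positivity), div_le_iff₀ hp]
  have hs : Real.pi * t ≤ Real.sinh (Real.pi * t) :=
    Real.self_le_sinh_iff.2 (by positivity)
  rw [Real.sinh_eq] at hs
  have e1 : Real.exp (2 * Real.pi * t) = Real.exp (Real.pi * t) * Real.exp (Real.pi * t) := by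
    rw [← Real.exp_add]; ring_nf
  have e2 : Real.exp (Real.pi * t) * Real.exp (-(Real.pi * t)) = 1 := by
    rw [← Real.exp_add]; simp
  rw [e1, neg_mul]
  have : 1 / (2 * Real.pi) * Real.exp (-(Real.pi * t)) *
      (Real.exp (Real.pi * t) * Real.exp (Real.pi * t) - 1) =
      1 / (2 * Real.pi) * (Real.exp (Real.pi * t) - Real.exp (-(Real.pi * t))) := by
    linear_combination (1 / (2 * Real.pi) * Real.exp (Real.pi * t)) * e2
  rw [this, one_div, inv_mul_eq_div, le_div_iff₀ (by positivity)]
  linarith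

theorem hasSum_exp_neg_mul {a : ℝ} (ha : 0 < a) :
    HasSum (fun n : ℕ => Real.exp (-(a * (n + 1)))) (1 / (Real.exp a - 1)) := by
  have h := (hasSum_geometric_of_lt_one (Real.exp_pos (-a)).le
    (Real.exp_lt_one_iff.2 (by linarith))).mul_left (Real.exp (-a))
  have e1 : (fun n : ℕ => Real.exp (-(a * (n + 1)))) =
      fun n : ℕ => Real.exp (-a) * Real.exp (-a) ^ n := by
    funext n
    rw [← Real.exp_nat_mul, ← Real.exp_add]
    ring_nf
  have e2 : 1 / (Real.exp a - 1) = Real.exp (-a) * (1 - Real.exp (-a))⁻¹ := by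
    have h0 := Real.exp_pos a
    have : 1 < Real.exp a := Real.one_lt_exp_iff.2 ha
    have h1 : Real.exp a - 1 ≠ 0 := by linarith
    have h2 : 1 - Real.exp (-a) = (Real.exp a - 1) / Real.exp a := by
      rw [Real.exp_neg]; field_simp
    rw [h2, Real.exp_neg]
    field_simp
  rw [e1, e2]
  exact h

theorem summable_inv_two_pi_sq : Summable fun n : ℕ => 1 / (2 * Real.pi * ((n : ℝ) + 1)) ^ 2 := by
  have h := (summable_nat_add_iff 1).2 (Real.summable_one_div_nat_pow.2 one_lt_two)
  refine (h.mul_left (1 / (2 * Real.pi) ^ 2)).congr fun n => ?_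
  push_cast
  field_simp

/-- The kernel `∫_0^∞ 2 sin(ts) / (e^{2πt} - 1) dt` of Binet's formulas. -/
noncomputable def binetKernel (s : ℝ) : ℝ :=
  ∫ t in Set.Ioi (0 : ℝ), 2 * Real.sin (s * t) / (Real.exp (2 * Real.pi * t) - 1)

/-- Expand `1/(e^{2πt}-1)` as a geometric series and integrate termwise; `|sin(st)| ≤ st` bounds the
norms by a multiple of `∑ 1/(n+1)²`. -/
theorem hasSum_binetKernel {s : ℝ} (hs : 0 ≤ s) :
    HasSum (fun n : ℕ => 2 * s / ((2 * Real.pi * (n + 1)) ^ 2 + s ^ 2)) (binetKernel s) := by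
  have hpos (n : ℕ) : 0 < 2 * Real.pi * ((n : ℝ) + 1) := by positivity
  have hint (n : ℕ) := integrableOn_sin_mul_exp_neg_mul (hpos n) s
  have h := hasSum_integral_of_summable_integral_norm (μ := volume.restrict (Set.Ioi (0 : ℝ)))
    (F := fun (n : ℕ) t => 2 * (Real.sin (s * t) * Real.exp (-(2 * Real.pi * ((n : ℝ) + 1)) * t)))
    (fun n => (hint n).1.const_mul 2) ?_
  · have e1 : (fun n : ℕ => 2 * s / ((2 * Real.pi * (n + 1)) ^ 2 + s ^ 2)) = fun n : ℕ =>
        ∫ t in Set.Ioi (0 : ℝ),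
          2 * (Real.sin (s * t) * Real.exp (-(2 * Real.pi * ((n : ℝ) + 1)) * t)) := by
      funext n
      rw [integral_const_mul, (hint n).2]
      ring
    have e2 : binetKernel s = ∫ t in Set.Ioi (0 : ℝ), ∑' n : ℕ,
        2 * (Real.sin (s * t) * Real.exp (-(2 * Real.pi * ((n : ℝ) + 1)) * t)) := by
      refine setIntegral_congr_fun measurableSet_Ioi fun t ht => ?_
      have ht : 0 < t := ht
      have h1 := ((hasSum_exp_neg_mul (a := 2 * Real.pi * t) (by positivity)).mul_left
        (2 * Real.sin (s * t))).tsum_eq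
      rw [mul_one_div] at h1
      rw [← h1]
      refine tsum_congr fun n => ?_
      rw [← mul_assoc]
      ring_nf
    rw [e1, e2]
    exact h
  · refine Summable.of_nonneg_of_le (fun n => integral_nonneg fun _ => norm_nonneg _) (fun n => ?_)
      (summable_inv_two_pi_sq.mul_left (2 * s))
    have h2 := integrableOn_mul_exp_neg_mul (hpos n)
    rw [← h2.2, ← integral_const_mul]
    refine setIntegral_mono_on ((hint n).1.const_mul 2).norm (h2.1.const_mul _) measurableSet_Ioi
      fun t ht => ?_
    have ht : 0 < t := ht
    rw [norm_mul, norm_mul, Real.norm_of_nonneg (Real.exp_pos _).le, Real.norm_eq_abs,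
      Real.norm_eq_abs, abs_two]
    have := abs_sin_mul_le s hs ht.le
    calc 2 * (|Real.sin (s * t)| * Real.exp (-(2 * Real.pi * ((n : ℝ) + 1)) * t))
        ≤ 2 * ((s * t) * Real.exp (-(2 * Real.pi * ((n : ℝ) + 1)) * t)) := by gcongr
      _ = _ := by ring

/-- The series for the kernel is the partial fraction expansion of the cotangent at `z = is/(2π)`,
where `e^{2πiz} = e^{-s}`. -/
theorem binetKernel_eq {s : ℝ} (hs : 0 < s) :
    binetKernel s = 1 / (Real.exp s - 1) - 1 / s + 1 / 2 := by
  set z : ℂ := (s / (2 * Real.pi) : ℝ) * Complex.I with hz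
  have hzim : z.im ≠ 0 := by
    rw [hz, Complex.im_ofReal_mul, Complex.I_im, mul_one]
    positivity
  have hzm : z ∈ Complex.integerComplement := by
    rintro ⟨n, hn⟩
    apply hzim
    rw [← hn]; simp
  have hcot := cot_series_rep' hzm
  have hpi : (Real.pi : ℂ) ≠ 0 := by exact_mod_cast Real.pi_ne_zero
  have hsc : (s : ℂ) ≠ 0 := by exact_mod_cast hs.ne'
  have hI : Complex.I * Complex.I = -1 := Complex.I_mul_I
  have hterm (n : ℕ) : 1 / (z - (n + 1)) + 1 / (z + (n + 1)) =
      -(2 * Real.pi * Complex.I) * ((2 * s / ((2 * Real.pi * (n + 1)) ^ 2 + s ^ 2) : ℝ) : ℂ) := by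
    have e1 : z - (n + 1) ≠ 0 := fun h => hzim (by have := congrArg Complex.im h; simpa using this)
    have e2 : z + (n + 1) ≠ 0 := fun h => hzim (by have := congrArg Complex.im h; simpa using this)
    have e3 : ((2 * Real.pi * (n + 1)) ^ 2 + s ^ 2 : ℂ) ≠ 0 := by
      have : (0 : ℝ) < (2 * Real.pi * (n + 1)) ^ 2 + s ^ 2 := by positivity
      exact_mod_cast this.ne'
    have e4 : (z - (n + 1)) * (z + (n + 1)) =
        -((2 * Real.pi * (n + 1)) ^ 2 + s ^ 2) / (2 * Real.pi) ^ 2 := by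
      rw [hz]; push_cast
      field_simp
      linear_combination (s : ℂ) ^ 2 * hI
    rw [div_add_div _ _ e1 e2, e4]
    push_cast
    rw [hz]; push_cast
    field_simp
    ring
  rw [tsum_congr hterm, tsum_mul_left, ← Complex.ofReal_tsum, (hasSum_binetKernel hs.le).tsum_eq,
    Complex.cot_pi_eq_exp_ratio] at hcot
  have hexp : 2 * Real.pi * Complex.I * z = ((-s : ℝ) : ℂ) := by
    rw [hz]; push_cast
    field_simp
    linear_combination hI
  rw [hexp, ← Complex.ofReal_exp, hz] at hcot
  have hE : 1 < Real.exp s := Real.one_lt_exp_iff.2 hs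
  rw [Real.exp_neg] at hcot
  have hE1 : (Real.exp s : ℂ) - 1 ≠ 0 := by
    have : Real.exp s - 1 ≠ 0 := by linarith
    exact_mod_cast this
  have hE2 : (Real.exp s : ℂ) ≠ 0 := by exact_mod_cast (Real.exp_pos s).ne'
  have : (binetKernel s : ℂ) = 1 / (Real.exp s - 1) - 1 / s + 1 / 2 := by
    have h2 : -(2 * Real.pi * Complex.I) ≠ 0 := by simp [hpi]
    apply mul_left_cancel₀ h2
    rw [← hcot]
    push_cast
    rw [Complex.ofReal_exp] at hE1 hE2
    have hE3 : 1 - (Complex.exp s)⁻¹ = (Complex.exp s - 1) / Complex.exp s := by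
      field_simp
    rw [hE3]
    field_simp
    ring_nf
    simp only [Complex.I_sq]
    ring
  apply Complex.ofReal_injective
  rw [this]
  push_cast
  rfl

/-- Supplies the hypothesis of Fubini in both exchanges of integrals below. -/
theorem integrable_prod_of_norm_le_mul {μ ν : Measure ℝ} [SFinite μ] [SFinite ν]
    {s t : Set ℝ} (hs : MeasurableSet s) (ht : MeasurableSet t) {F : ℝ × ℝ → ℝ} {f g : ℝ → ℝ}
    (hF : Measurable F) (hf : IntegrableOn f s μ) (hg : IntegrableOn g t ν)
    (h : ∀ x ∈ s, ∀ y ∈ t, ‖F (x, y)‖ ≤ f x * g y) :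
    Integrable F ((μ.restrict s).prod (ν.restrict t)) := by
  refine Integrable.mono' (hf.mul_prod hg) hF.aestronglyMeasurable ?_
  rw [Measure.prod_restrict]
  exact ae_restrict_of_forall_mem (hs.prod ht) fun z hz => h z.1 hz.1 z.2 hz.2

/-- The integral `∫_0^∞ 2t / ((t² + x²)(e^{2πt} - 1)) dt` of Binet's second formula. -/
noncomputable def binetIntegral (x : ℝ) : ℝ :=
  ∫ t in Set.Ioi (0 : ℝ), 2 * t / ((t ^ 2 + x ^ 2) * (Real.exp (2 * Real.pi * t) - 1))

/-- Binet's integral is the Laplace transform of the kernel: integrate first in `s`, using the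
Laplace transform of the sine. -/
theorem integrable_binetKernel_mul_exp {x : ℝ} (hx : 0 < x) :
    IntegrableOn (fun s => binetKernel s * Real.exp (-x * s)) (Set.Ioi 0) ∧
      ∫ s in Set.Ioi (0 : ℝ), binetKernel s * Real.exp (-x * s) = binetIntegral x := by
  have hprod := integrable_prod_of_norm_le_mul (μ := volume) (ν := volume) measurableSet_Ioi
    measurableSet_Ioi
    (F := fun z : ℝ × ℝ => 2 * Real.sin (z.1 * z.2) / (Real.exp (2 * Real.pi * z.2) - 1) *
      Real.exp (-x * z.1)) (by fun_prop)
    ((integrableOn_mul_exp_neg_mul hx).1.const_mul 2) integrableOn_div_exp_sub_one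
    (fun s hs t ht => by
      have hs : 0 < s := hs
      have ht : 0 < t := ht
      have hp := exp_two_pi_mul_sub_one_pos ht
      rw [norm_mul, norm_div, norm_mul, Real.norm_of_nonneg (Real.exp_pos _).le,
        Real.norm_of_nonneg hp.le, Real.norm_of_nonneg two_pos.le, Real.norm_eq_abs]
      calc 2 * |Real.sin (s * t)| / (Real.exp (2 * Real.pi * t) - 1) * Real.exp (-x * s)
          ≤ 2 * (s * t) / (Real.exp (2 * Real.pi * t) - 1) * Real.exp (-x * s) := by
            gcongr
            exact abs_sin_mul_le s hs.le ht.le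
        _ = _ := by ring)
  have hk (s : ℝ) : ∫ t in Set.Ioi (0 : ℝ), 2 * Real.sin (s * t) /
      (Real.exp (2 * Real.pi * t) - 1) * Real.exp (-x * s) = binetKernel s * Real.exp (-x * s) := by
    rw [integral_mul_const, binetKernel]
  refine ⟨?_, ?_⟩
  · have := hprod.integral_prod_left
    simp only [hk] at this
    exact this
  · have hswap := integral_integral_swap (f := fun s t : ℝ =>
      2 * Real.sin (s * t) / (Real.exp (2 * Real.pi * t) - 1) * Real.exp (-x * s)) hprod
    simp only [hk] at hswap
    rw [hswap, binetIntegral]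
    refine setIntegral_congr_fun measurableSet_Ioi fun t ht => ?_
    have ht : 0 < t := ht
    have hp := exp_two_pi_mul_sub_one_pos ht
    have h1 := (integrableOn_sin_mul_exp_neg_mul hx t).2
    have h2 : (fun s : ℝ => 2 * Real.sin (s * t) / (Real.exp (2 * Real.pi * t) - 1) *
        Real.exp (-x * s)) = fun s : ℝ => 2 / (Real.exp (2 * Real.pi * t) - 1) *
        (Real.sin (t * s) * Real.exp (-x * s)) := by
      funext s
      rw [mul_comm s t]
      ring
    have h3 : x ^ 2 + t ^ 2 ≠ 0 := by positivity
    simp only [h2]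
    rw [integral_const_mul, h1, add_comm (t ^ 2)]
    field_simp

theorem integral_Ioi_exp_neg_mul {x : ℝ} (hx : 0 < x) :
    ∫ s in Set.Ioi (0 : ℝ), Real.exp (-x * s) = 1 / x := by
  rw [integral_exp_mul_Ioi (by linarith)]
  simp

/-- Taking the difference multiplies the kernel by `1 - e^{-s}`, which cancels `e^s - 1`. What
remains are two exponentials and the Frullani integral of `(e^{-xs} - e^{-(x+1)s})/s`. -/
theorem binetIntegral_sub {x : ℝ} (hx : 0 < x) :
    binetIntegral x - binetIntegral (x + 1) =
      1 / (2 * x) + 1 / (2 * (x + 1)) - Real.log ((x + 1) / x) := by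
  have hx1 : 0 < x + 1 := by linarith
  obtain ⟨i1, e1⟩ := integrable_binetKernel_mul_exp hx
  obtain ⟨i2, e2⟩ := integrable_binetKernel_mul_exp hx1
  have j1 := exp_neg_integrableOn_Ioi 0 hx
  have j2 := exp_neg_integrableOn_Ioi 0 hx1
  have hI : IntegrableOn (fun s => (1 / 2 * Real.exp (-x * s) + 1 / 2 * Real.exp (-(x + 1) * s)) -
      (binetKernel s * Real.exp (-x * s) - binetKernel s * Real.exp (-(x + 1) * s)))
      (Set.Ioi 0) := ((j1.const_mul _).add (j2.const_mul _)).sub (i1.sub i2)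
  have hEq : Set.EqOn (fun s => (1 / 2 * Real.exp (-x * s) + 1 / 2 * Real.exp (-(x + 1) * s)) -
      (binetKernel s * Real.exp (-x * s) - binetKernel s * Real.exp (-(x + 1) * s)))
      (fun s => s⁻¹ • (Real.exp (-(x * s)) - Real.exp (-((x + 1) * s)))) (Set.Ioi 0) := by
    intro s hs
    have hs : 0 < s := hs
    have hE : 1 < Real.exp s := Real.one_lt_exp_iff.2 hs
    have hE1 : Real.exp s - 1 ≠ 0 := by linarith
    have h1 : Real.exp (-(x + 1) * s) = Real.exp (-x * s) / Real.exp s := by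
      rw [← Real.exp_sub]; ring_nf
    simp only [smul_eq_mul, binetKernel_eq hs, ← neg_mul, h1]
    field_simp
    ring
  have hF := Frullani.integral_Ioi_eq (f := fun s : ℝ => Real.exp (-s)) (L := 1) (R := 0)
    ((by fun_prop : Continuous fun s : ℝ => Real.exp (-s)).locallyIntegrable.locallyIntegrableOn _)
    hx hx1 ?_ (Real.tendsto_exp_neg_atTop_nhds_zero)
    ((integrableOn_congr_fun hEq measurableSet_Ioi).1 hI)
  · rw [← setIntegral_congr_fun measurableSet_Ioi hEq, integral_sub, integral_sub i1 i2, e1, e2,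
      integral_add (j1.const_mul _) (j2.const_mul _), integral_const_mul, integral_const_mul,
      integral_Ioi_exp_neg_mul hx, integral_Ioi_exp_neg_mul hx1] at hF
    · simp only [sub_zero, smul_eq_mul, mul_one] at hF
      rw [← hF]
      field_simp
      ring
    · exact (j1.const_mul _).add (j2.const_mul _)
    · exact i1.sub i2
  · have : Continuous fun s : ℝ => Real.exp (-s) := by fun_prop
    simpa using (this.tendsto 0).mono_left nhdsWithin_le_nhds

theorem binetIntegral_nonneg (x : ℝ) : 0 ≤ binetIntegral x :=
  setIntegral_nonneg measurableSet_Ioi fun t ht => by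
    have ht : 0 < t := ht
    have hp := exp_two_pi_mul_sub_one_pos ht
    positivity

theorem binetIntegrand_le {x t : ℝ} (hx : 0 < x) (ht : 0 < t) :
    2 * t / ((t ^ 2 + x ^ 2) * (Real.exp (2 * Real.pi * t) - 1)) ≤
      2 / x ^ 2 * (t / (Real.exp (2 * Real.pi * t) - 1)) := by
  have hp := exp_two_pi_mul_sub_one_pos ht
  calc _ ≤ 2 * t / (x ^ 2 * (Real.exp (2 * Real.pi * t) - 1)) := by
        gcongr
        nlinarith
    _ = _ := by field_simp

theorem binetIntegral_le {x : ℝ} (hx : 0 < x) :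
    binetIntegral x ≤
      2 / x ^ 2 * ∫ t in Set.Ioi (0 : ℝ), t / (Real.exp (2 * Real.pi * t) - 1) := by
  rw [← integral_const_mul]
  refine integral_mono_of_nonneg ?_ (integrableOn_div_exp_sub_one.const_mul _) ?_
  · refine ae_restrict_of_forall_mem measurableSet_Ioi fun t ht => ?_
    have ht : 0 < t := ht
    have hp := exp_two_pi_mul_sub_one_pos ht
    simp only [Pi.zero_apply]
    positivity
  · exact ae_restrict_of_forall_mem measurableSet_Ioi fun t ht => binetIntegrand_le hx ht

theorem tendsto_binetIntegral : Tendsto binetIntegral atTop (𝓝 0) := by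
  refine squeeze_zero' (Eventually.of_forall binetIntegral_nonneg)
    ((eventually_gt_atTop 0).mono fun x hx => binetIntegral_le hx) ?_
  have h : Tendsto (fun x : ℝ => 2 / x ^ 2) atTop (𝓝 0) :=
    tendsto_const_nhds.div_atTop (tendsto_pow_atTop two_ne_zero)
  simpa using h.mul_const _

/-- Binet's second formula, for the digamma function. -/
theorem log_add_sub_psi_eq_binetIntegral {x : ℝ} (hx : 0 < x) :
    Real.log x + 1 / (2 * x) - psi (x + 1) = binetIntegral x := by
  -- The defect `D` is unchanged by `y ↦ y + 1` and tends to `0` at infinity, hence vanishes.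
  set D : ℝ → ℝ := fun y => Real.log y + 1 / (2 * y) - psi (y + 1) - binetIntegral y with hD
  have hper {y : ℝ} (hy : 0 < y) : D (y + 1) = D y := by
    have h1 := binetIntegral_sub hy
    have h2 := psi_add_one_of_pos (x := y + 1) (by linarith)
    rw [Real.log_div (by linarith) hy.ne'] at h1
    have h3 : 1 / (y + 1) = 2 * (1 / (2 * (y + 1))) := by field_simp
    simp only [hD]
    linarith
  have hn (n : ℕ) : D (x + n) = D x := by
    induction n with
    | zero => simp
    | succ n ih =>
      push_cast
      rw [← add_assoc, hper (by positivity), ih]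
  have hlim : Tendsto D atTop (𝓝 0) := by
    have hinv : Tendsto (fun y : ℝ => 1 / y) atTop (𝓝 0) := by
      simpa using tendsto_inv_atTop_zero (𝕜 := ℝ)
    have h1 : Tendsto (fun y : ℝ => psi (y + 1) - Real.log y) atTop (𝓝 0) := by
      refine squeeze_zero' ?_ ?_ hinv
      · filter_upwards [eventually_gt_atTop 0] with y hy
        linarith [log_le_psi_add_one hy]
      · filter_upwards [eventually_gt_atTop 0] with y hy
        linarith [psi_add_one_le hy]
    have h2 := ((hinv.const_mul (1 / 2)).sub h1).sub tendsto_binetIntegral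
    simp only [mul_zero, sub_zero] at h2
    refine h2.congr fun y => ?_
    simp only [hD]
    rw [one_div_mul_one_div]
    ring
  have h0 : D x = 0 := by
    have h := hlim.comp (tendsto_atTop_add_const_left atTop x tendsto_natCast_atTop_atTop)
    exact tendsto_nhds_unique tendsto_const_nhds (h.congr hn)
  simp only [hD] at h0
  linarith

/-! ### The integral of `ψ(x+1)/x` and the logarithmic integral. -/

theorem integral_Ioi_one_div_mul_add_sq {t : ℝ} (ht : 0 < t) :
    ∫ x in Set.Ioi (1 : ℝ), t ^ 2 / (x * (t ^ 2 + x ^ 2)) = 1 / 2 * Real.log (1 + t ^ 2) := by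
  have hd : ∀ x ∈ Set.Ici (1 : ℝ), HasDerivAt
      (fun x : ℝ => -(1 / 2) * Real.log (1 + t ^ 2 * (x ^ 2)⁻¹))
      (t ^ 2 / (x * (t ^ 2 + x ^ 2))) x := by
    intro x hx
    have hx : 0 < x := zero_lt_one.trans_le hx
    have h1 : HasDerivAt (fun x : ℝ => 1 + t ^ 2 * (x ^ 2)⁻¹)
        (t ^ 2 * (-(2 * x) / (x ^ 2) ^ 2)) x := by
      have := (((hasDerivAt_pow 2 x).inv (by positivity)).const_mul (t ^ 2)).const_add 1
      simpa using! this
    have h2 : 1 + t ^ 2 * (x ^ 2)⁻¹ ≠ 0 := by positivity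
    refine ((h1.log h2).const_mul (-(1 / 2))).congr_deriv ?_
    field_simp
    ring
  have hlim : Tendsto (fun x : ℝ => -(1 / 2) * Real.log (1 + t ^ 2 * (x ^ 2)⁻¹)) atTop (𝓝 0) := by
    have h1 : Tendsto (fun x : ℝ => 1 + t ^ 2 * (x ^ 2)⁻¹) atTop (𝓝 1) := by
      have : Tendsto (fun x : ℝ => (x ^ 2)⁻¹) atTop (𝓝 0) :=
        tendsto_inv_atTop_zero.comp (tendsto_pow_atTop two_ne_zero)
      simpa using (this.const_mul (t ^ 2)).const_add 1
    have h2 := ((Real.continuousAt_log one_ne_zero).tendsto.comp h1).const_mul (-(1 / 2))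
    rwa [Real.log_one, mul_zero] at h2
  rw [integral_Ioi_of_hasDerivAt_of_nonneg' hd (fun x hx => ?_) hlim]
  · simp
  · have hx : 0 < x := zero_lt_one.trans hx
    positivity

/-- Fubini with majorant `2x^{-3} · t/(e^{2πt}-1)`; the inner integral over `x > 1` produces
`ln(1+t²)`. -/
theorem integrableOn_binetIntegral_div :
    IntegrableOn (fun x => binetIntegral x / x) (Set.Ioi 1) ∧
      IntegrableOn logIntegrand (Set.Ioi 0) ∧
      ∫ x in Set.Ioi (1 : ℝ), binetIntegral x / x = ∫ t in Set.Ioi (0 : ℝ), logIntegrand t := by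
  have hprod := integrable_prod_of_norm_le_mul (μ := volume) (ν := volume) measurableSet_Ioi
    measurableSet_Ioi (s := Set.Ioi 1) (t := Set.Ioi 0)
    (F := fun z : ℝ × ℝ =>
      2 * z.2 / ((z.2 ^ 2 + z.1 ^ 2) * (Real.exp (2 * Real.pi * z.2) - 1)) / z.1) (by fun_prop)
    ((integrableOn_Ioi_rpow_of_lt (by norm_num : (-3 : ℝ) < -1) one_pos).const_mul 2)
    integrableOn_div_exp_sub_one
    (fun x hx t ht => by
      have hx : 0 < x := zero_lt_one.trans hx
      have ht : 0 < t := ht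
      have hp := exp_two_pi_mul_sub_one_pos ht
      rw [Real.norm_of_nonneg (by positivity)]
      have hrp : x ^ (-3 : ℝ) = 1 / x ^ 3 := by
        rw [Real.rpow_neg hx.le, one_div]
        norm_cast
      calc _ ≤ 2 / x ^ 2 * (t / (Real.exp (2 * Real.pi * t) - 1)) / x := by
            gcongr
            exact binetIntegrand_le hx ht
        _ = _ := by
            rw [hrp]
            field_simp)
  have hk (x : ℝ) : ∫ t in Set.Ioi (0 : ℝ), 2 * t / ((t ^ 2 + x ^ 2) *
      (Real.exp (2 * Real.pi * t) - 1)) / x = binetIntegral x / x := by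
    rw [integral_div, binetIntegral]
  have hl : Set.EqOn (fun t => ∫ x in Set.Ioi (1 : ℝ), 2 * t / ((t ^ 2 + x ^ 2) *
      (Real.exp (2 * Real.pi * t) - 1)) / x) logIntegrand (Set.Ioi 0) := by
    intro t ht
    have ht : 0 < t := ht
    have hp := exp_two_pi_mul_sub_one_pos ht
    have h2 : Set.EqOn (fun x : ℝ => 2 * t / ((t ^ 2 + x ^ 2) *
      (Real.exp (2 * Real.pi * t) - 1)) / x) (fun x => 2 / (t * (Real.exp (2 * Real.pi * t) - 1)) *
        (t ^ 2 / (x * (t ^ 2 + x ^ 2)))) (Set.Ioi 1) := by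
      intro x hx
      have hx : 0 < x := zero_lt_one.trans hx
      simp only
      field_simp
    simp only
    rw [setIntegral_congr_fun measurableSet_Ioi h2, integral_const_mul,
      integral_Ioi_one_div_mul_add_sq ht, logIntegrand]
    field_simp
  refine ⟨?_, ?_, ?_⟩
  · have := hprod.integral_prod_left
    simp only [hk] at this
    exact this
  · have := hprod.integral_prod_right
    exact (integrableOn_congr_fun hl measurableSet_Ioi).1 this
  · have hswap := integral_integral_swap (f := fun x t : ℝ => 2 * t / ((t ^ 2 + x ^ 2) *
      (Real.exp (2 * Real.pi * t) - 1)) / x) hprod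
    simp only [hk] at hswap
    rw [hswap]
    exact setIntegral_congr_fun measurableSet_Ioi hl

/-- Integrating Binet's formula divided by `x`: `ln x/x` gives `ln²n/2`, and `1/(2x²)` gives the
constant `1/2`. -/
theorem tendsto_integral_psi_add_one_div :
    Tendsto (fun n : ℕ => (∫ x in (1 : ℝ)..(n : ℝ), psi (x + 1) / x ^ 1) - Real.log n ^ 2 / 2) atTop
      (𝓝 (1 / 2 - ∫ t in Set.Ioi (0 : ℝ), logIntegrand t)) := by
  obtain ⟨hi, -, he⟩ := integrableOn_binetIntegral_div
  have h1 := intervalIntegral_tendsto_integral_Ioi 1 hi tendsto_natCast_atTop_atTop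
  rw [he] at h1
  have h2 : Tendsto (fun n : ℕ => 1 / 2 * (1 - 1 / (n : ℝ))) atTop (𝓝 (1 / 2)) := by
    have h := ((tendsto_one_div_atTop_nhds_zero_nat (𝕜 := ℝ)).const_sub 1).const_mul (1 / 2)
    rwa [sub_zero, mul_one] at h
  refine (h2.sub h1).congr' ?_
  filter_upwards [eventually_ge_atTop 1] with n hn
  have hn : (1 : ℝ) ≤ n := by exact_mod_cast hn
  have hd : ∀ x ∈ Set.uIcc (1 : ℝ) n, HasDerivAt
      (fun x => Real.log x ^ 2 / 2 - 1 / 2 * x⁻¹) (Real.log x / x + 1 / 2 * (x ^ 2)⁻¹) x := by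
    intro x hx
    rw [Set.uIcc_of_le hn] at hx
    have hx : x ≠ 0 := (zero_lt_one.trans_le hx.1).ne'
    refine ((((Real.hasDerivAt_log hx).pow 2).div_const 2).sub
      ((hasDerivAt_inv hx).const_mul (1 / 2))).congr_deriv ?_
    field_simp
    ring
  have hc : ContinuousOn (fun x => Real.log x / x + 1 / 2 * (x ^ 2)⁻¹) (Set.uIcc (1 : ℝ) n) := by
    intro x hx
    rw [Set.uIcc_of_le hn] at hx
    have hx : x ≠ 0 := (zero_lt_one.trans_le hx.1).ne'
    exact ContinuousAt.continuousWithinAt (by fun_prop (disch := simp [hx]))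
  have hI := intervalIntegral.integral_eq_sub_of_hasDerivAt hd hc.intervalIntegrable
  have hb : IntervalIntegrable (fun x => binetIntegral x / x) volume 1 n := by
    rw [intervalIntegrable_iff_integrableOn_Ioc_of_le hn]
    exact hi.mono_set Set.Ioc_subset_Ioi_self
  have heq : ∫ x in (1 : ℝ)..n, psi (x + 1) / x ^ 1 = ∫ x in (1 : ℝ)..n,
      ((Real.log x / x + 1 / 2 * (x ^ 2)⁻¹) - binetIntegral x / x) := by
    refine intervalIntegral.integral_congr fun x hx => ?_
    rw [Set.uIcc_of_le hn] at hx
    have hx : 0 < x := zero_lt_one.trans_le hx.1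
    rw [← log_add_sub_psi_eq_binetIntegral hx]
    field_simp
    ring
  rw [heq, intervalIntegral.integral_sub hc.intervalIntegrable hb, hI]
  simp
  ring

/-! ### Stirling expansion and closed forms of the hyperharmonic terms. -/

theorem prod_range_add_eq_sum_stirlingFirst (x : ℝ) (r : ℕ) :
    ∏ i ∈ Finset.range r, (x + i) =
      ∑ j ∈ Finset.range (r + 1), (Nat.stirlingFirst r j : ℝ) * x ^ j := by
  induction r with
  | zero => simp
  | succ r ih =>
    have h0 : (r : ℝ) * Nat.stirlingFirst r 0 = 0 := by
      cases r <;> simp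
    have h1 : ∑ j ∈ Finset.range (r + 1), (Nat.stirlingFirst r (j + 1) : ℝ) * x ^ (j + 1) =
        ∑ j ∈ Finset.range (r + 1), (Nat.stirlingFirst r j : ℝ) * x ^ j -
          Nat.stirlingFirst r 0 := by
      have h2 := Finset.sum_range_succ' (fun j => (Nat.stirlingFirst r j : ℝ) * x ^ j) (r + 1)
      rw [Finset.sum_range_succ, Nat.stirlingFirst_eq_zero_of_lt (Nat.lt_succ_self r)] at h2
      simp only [Nat.cast_zero, zero_mul, add_zero, pow_zero, mul_one] at h2
      linarith
    rw [Finset.prod_range_succ, ih, Finset.sum_range_succ' _ (r + 1), Nat.stirlingFirst_succ_zero]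
    simp only [Nat.stirlingFirst_succ_succ, Nat.cast_add, Nat.cast_mul, add_mul,
      Finset.sum_add_distrib, mul_assoc, Nat.cast_zero, zero_mul, add_zero]
    rw [← Finset.mul_sum, h1, mul_sub, h0, mul_add, Finset.sum_mul, mul_comm _ (r : ℝ), sub_zero,
      add_comm]
    congr 1
    exact Finset.sum_congr rfl fun j _ => by rw [pow_succ]; ring

/-- The Laurent polynomial `x(x+1)⋯(x+r-1) / x^{r+1}`, expanded with Stirling numbers. -/
noncomputable def stirlingLaurent (r : ℕ) (x : ℝ) : ℝ :=
  ∑ j ∈ Finset.Ico 1 (r + 1), (Nat.stirlingFirst r j : ℝ) / x ^ (r + 1 - j)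

theorem stirlingLaurent_eq {r : ℕ} (hr : 1 ≤ r) {x : ℝ} (hx : x ≠ 0) :
    stirlingLaurent r x = (∏ i ∈ Finset.range r, (x + i)) / x ^ (r + 1) := by
  rw [prod_range_add_eq_sum_stirlingFirst, Finset.range_eq_Ico, Finset.sum_eq_sum_Ico_succ_bot
    (Nat.succ_pos r)]
  obtain ⟨R, rfl⟩ := Nat.exists_eq_add_of_le' hr
  -- The term `j = 0` drops out because `r ≥ 1`.
  rw [Nat.stirlingFirst_succ_zero, Nat.cast_zero, zero_mul, zero_add, Finset.sum_div,
    stirlingLaurent]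
  refine Finset.sum_congr rfl fun j hj => ?_
  rw [Finset.mem_Ico] at hj
  rw [div_eq_div_iff (by positivity) (by positivity), mul_assoc, ← pow_add]
  congr 2
  omega

theorem Real.Gamma_add_nat_eq_prod {x : ℝ} (hx : 0 < x) (r : ℕ) :
    Real.Gamma (x + r) = (∏ i ∈ Finset.range r, (x + i)) * Real.Gamma x := by
  induction r with
  | zero => simp
  | succ r ih =>
    push_cast
    rw [← add_assoc, Real.Gamma_add_one (by positivity), ih, Finset.prod_range_succ]
    ring

theorem psi_add_nat {x : ℝ} (hx : 0 < x) {r : ℕ} (hr : 1 ≤ r) :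
    psi (x + r) = psi (x + 1) + ∑ i ∈ Finset.Ico 1 r, 1 / (x + i) := by
  induction r, hr using Nat.le_induction with
  | base => simp
  | succ r hr ih =>
    push_cast
    rw [← add_assoc, psi_add_one_of_pos (by positivity), ih, Finset.sum_Ico_succ_top hr]
    ring

theorem Gamma_mul_hyperharmonicExt_div {r : ℕ} (hr : 1 ≤ r) {x : ℝ} (hx : 0 < x) :
    Real.Gamma r * (hyperharmonicExt r x / x ^ r) =
      stirlingLaurent r x * (psi (x + r) - psi r) := by
  have h1 : Real.Gamma r ≠ 0 := (Real.Gamma_pos_of_pos (by exact_mod_cast hr)).ne'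
  have h2 : Real.Gamma x ≠ 0 := (Real.Gamma_pos_of_pos hx).ne'
  rw [stirlingLaurent_eq hr hx.ne', hyperharmonicExt, if_neg (by omega), risingPow,
    Real.Gamma_add_nat_eq_prod hx]
  field_simp
  ring

theorem harm_succ (n : ℕ) : harm (n + 1) = harm n + 1 / ((n : ℝ) + 1) := by
  simp [harm]

theorem sum_Icc_one_eq_sum_range (f : ℕ → ℝ) (n : ℕ) :
    ∑ k ∈ Finset.Icc 1 n, f k = ∑ i ∈ Finset.range n, f (i + 1) := by
  induction n with
  | zero => simp
  | succ n ih => rw [Finset.sum_Icc_succ_top (by omega), ih, Finset.sum_range_succ]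

/-- Induction on `R` and, inside it, on `n`: Pascal's rule handles the binomials, and the absorption
identity `hq` handles the two reciprocals split off the harmonic numbers. -/
theorem hyperharmonic_succ_eq (R n : ℕ) :
    hyperharmonic (R + 1) n = ((n + R).choose R : ℝ) * (harm (n + R) - harm R) := by
  induction R generalizing n with
  | zero =>
    simp only [hyperharmonic, sum_Icc_one_eq_sum_range]
    simp [harm, harmonic]
  | succ R ih =>
    induction n with
    | zero => simp [hyperharmonic]
    | succ n ihn =>
      have hrec : hyperharmonic (R + 2) (n + 1) =
          hyperharmonic (R + 2) n + hyperharmonic (R + 1) (n + 1) := by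
        rw [hyperharmonic, Finset.sum_Icc_succ_top (by omega), ← hyperharmonic]
      rw [hrec, ihn, ih]
      have e1 : n + 1 + R = n + (R + 1) := by ring
      have e2 : n + 1 + (R + 1) = n + (R + 1) + 1 := by ring
      have hp : ((n + (R + 1) + 1).choose (R + 1) : ℝ) =
          (n + (R + 1)).choose R + (n + (R + 1)).choose (R + 1) := by
        exact_mod_cast Nat.choose_succ_succ _ _
      have hq : ((n : ℝ) + (R + 1) + 1) * (n + (R + 1)).choose R =
          ((n + (R + 1)).choose R + (n + (R + 1)).choose (R + 1)) * ((R : ℝ) + 1) := by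
        rw [← hp]
        exact_mod_cast Nat.add_one_mul_choose_eq (n + (R + 1)) R
      rw [e1, e2, hp, harm_succ (n + (R + 1)), harm_succ R]
      push_cast
      have h1 : (R : ℝ) + 1 ≠ 0 := by positivity
      have h2 : (n : ℝ) + (R + 1) + 1 ≠ 0 := by positivity
      field_simp
      linear_combination hq

theorem Gamma_mul_hyperharmonic_div {r : ℕ} (hr : 1 ≤ r) {n : ℕ} (hn : 1 ≤ n) :
    Real.Gamma r * (hyperharmonic r n / (n : ℝ) ^ r) =
      stirlingLaurent r n * (harm (n + r - 1) - harm (r - 1)) := by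
  obtain ⟨R, rfl⟩ := Nat.exists_eq_add_of_le' hr
  have hn0 : (n : ℝ) ≠ 0 := by positivity
  have h := Nat.ascFactorial_eq_factorial_mul_choose n R
  rw [Nat.ascFactorial_eq_prod_range] at h
  have h' : ∏ i ∈ Finset.range R, ((n : ℝ) + 1 + i) = R.factorial * (n + R).choose R := by
    exact_mod_cast h
  rw [stirlingLaurent_eq hr hn0, Finset.prod_range_succ', hyperharmonic_succ_eq, Nat.cast_succ,
    Real.Gamma_nat_eq_factorial, ← add_assoc, Nat.add_sub_cancel, Nat.add_sub_cancel]
  have h2 : ∏ i ∈ Finset.range R, ((n : ℝ) + (i + 1 : ℕ)) = R.factorial * (n + R).choose R := by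
    rw [← h']
    exact Finset.prod_congr rfl fun i _ => by push_cast; ring
  rw [h2]
  field_simp
  simp only [Nat.cast_zero, add_zero]
  ring

/-! ### The rational part of the integral. -/

theorem hasDerivAt_prod_range_add {x : ℝ} (hx : 0 < x) (r : ℕ) :
    HasDerivAt (fun x : ℝ => ∏ i ∈ Finset.range r, (x + i))
      ((∏ i ∈ Finset.range r, (x + i)) * ∑ i ∈ Finset.range r, 1 / (x + i)) x := by
  induction r with
  | zero => simpa using hasDerivAt_const x (1 : ℝ)
  | succ r ih =>
    have h1 : x + r ≠ 0 := by positivity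
    simp only [Finset.prod_range_succ, Finset.sum_range_succ]
    refine (ih.mul ((hasDerivAt_id x).add_const (r : ℝ))).congr_deriv ?_
    simp only [id]
    field_simp

/-- Logarithmic derivative of the product over `x^{r+1}`: the factor `i = 0` contributes `1/x`,
which lowers `(r+1)/x` to `r/x`. -/
theorem hasDerivAt_stirlingLaurent {r : ℕ} (hr : 1 ≤ r) {x : ℝ} (hx : 0 < x) :
    HasDerivAt (stirlingLaurent r)
      (stirlingLaurent r x * (∑ i ∈ Finset.Ico 1 r, 1 / (x + i)) -
        r * (stirlingLaurent r x / x)) x := by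
  have h := (hasDerivAt_prod_range_add hx r).div (hasDerivAt_pow (r + 1) x) (by positivity)
  refine (h.congr_of_eventuallyEq ?_).congr_deriv ?_
  · filter_upwards [eventually_gt_nhds hx] with y hy
    exact stirlingLaurent_eq hr hy.ne'
  · rw [stirlingLaurent_eq hr hx.ne', Finset.range_eq_Ico, Finset.sum_eq_sum_Ico_succ_bot hr]
    push_cast
    rw [add_zero]
    field_simp
    ring

theorem hasDerivAt_neg_inv_pow {x : ℝ} (hx : x ≠ 0) {p : ℕ} (hp : p ≠ 0) :
    HasDerivAt (fun x : ℝ => -(1 / x ^ p) / p) (1 / x ^ (p + 1)) x := by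
  have h := (((hasDerivAt_pow p x).inv (by positivity)).neg).div_const (p : ℝ)
  simp only [one_div]
  refine h.congr_deriv ?_
  obtain ⟨q, rfl⟩ := Nat.exists_eq_succ_of_ne_zero hp
  have : ((q : ℝ) + 1) ≠ 0 := by positivity
  simp only [Nat.succ_eq_add_one, Nat.add_sub_cancel]
  push_cast
  field_simp
  ring

theorem integral_inv_pow {y : ℝ} (hy : 1 ≤ y) {p : ℕ} (hp : p ≠ 0) :
    ∫ x in (1 : ℝ)..y, 1 / x ^ (p + 1) = (1 - 1 / y ^ p) / p := by
  have hpos : ∀ x ∈ Set.uIcc (1 : ℝ) y, x ≠ 0 := fun x hx => by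
    rw [Set.uIcc_of_le hy] at hx
    exact (zero_lt_one.trans_le hx.1).ne'
  rw [intervalIntegral.integral_eq_sub_of_hasDerivAt
    (fun x hx => hasDerivAt_neg_inv_pow (hpos x hx) hp)]
  · simp
    ring
  · exact (ContinuousOn.intervalIntegrable fun x hx => ContinuousAt.continuousWithinAt
      (by have := hpos x hx; fun_prop (disch := simp [this])))

/-- By the derivative formula the integrand is `L' + rL/x`, and `rL/x` integrates power by power;
`r!` is `L(1)`. -/
theorem integral_stirlingLaurent_mul_sum {r : ℕ} (hr : 1 ≤ r) {y : ℝ} (hy : 1 ≤ y) :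
    ∫ x in (1 : ℝ)..y, stirlingLaurent r x * ∑ i ∈ Finset.Ico 1 r, 1 / (x + i) =
      stirlingLaurent r y - r.factorial + r * ∑ j ∈ Finset.Ico 1 (r + 1),
        (Nat.stirlingFirst r j : ℝ) * ((1 - 1 / y ^ (r + 1 - j)) / ((r : ℝ) + 1 - j)) := by
  have hpos : ∀ x ∈ Set.uIcc (1 : ℝ) y, 0 < x := fun x hx => by
    rw [Set.uIcc_of_le hy] at hx
    exact zero_lt_one.trans_le hx.1
  have hd (x : ℝ) (hx : x ∈ Set.uIcc 1 y) : HasDerivAt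
      (fun x => stirlingLaurent r x + r * ∑ j ∈ Finset.Ico 1 (r + 1),
        (Nat.stirlingFirst r j : ℝ) * (-(1 / x ^ (r + 1 - j)) / (r + 1 - j : ℕ)))
      (stirlingLaurent r x * ∑ i ∈ Finset.Ico 1 r, 1 / (x + i)) x := by
    have hx := hpos x hx
    have h1 := HasDerivAt.fun_sum (u := Finset.Ico 1 (r + 1))
      (A := fun j x => (Nat.stirlingFirst r j : ℝ) * (-(1 / x ^ (r + 1 - j)) / (r + 1 - j : ℕ)))
      (A' := fun j => (Nat.stirlingFirst r j : ℝ) * (1 / x ^ (r + 1 - j + 1))) (x := x)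
      fun j hj => by
        rw [Finset.mem_Ico] at hj
        exact (hasDerivAt_neg_inv_pow hx.ne' (by omega)).const_mul _
    refine ((hasDerivAt_stirlingLaurent hr hx).add (h1.const_mul (r : ℝ))).congr_deriv ?_
    have h2 : ∑ j ∈ Finset.Ico 1 (r + 1), (Nat.stirlingFirst r j : ℝ) *
        (1 / x ^ (r + 1 - j + 1)) = stirlingLaurent r x / x := by
      rw [stirlingLaurent, Finset.sum_div]
      refine Finset.sum_congr rfl fun j _ => ?_
      rw [pow_succ]
      field_simp
    rw [h2]
    ring
  have hc : ContinuousOn (fun x => stirlingLaurent r x * ∑ i ∈ Finset.Ico 1 r, 1 / (x + i))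
      (Set.uIcc 1 y) := by
    intro x hx
    have hx := hpos x hx
    refine ((hasDerivAt_stirlingLaurent hr hx).continuousAt.mul ?_).continuousWithinAt
    refine tendsto_finsetSum _ fun i _ => ?_
    have : x + i ≠ 0 := by positivity
    exact ContinuousAt.tendsto (f := fun x : ℝ => 1 / (x + i)) (by fun_prop (disch := simp [this]))
  have hone : stirlingLaurent r 1 = r.factorial := by
    rw [stirlingLaurent_eq hr one_ne_zero, one_pow, div_one, ← Finset.prod_range_add_one_eq_factorial]
    push_cast
    exact Finset.prod_congr rfl fun i _ => add_comm _ _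
  rw [intervalIntegral.integral_eq_sub_of_hasDerivAt hd hc.intervalIntegrable, hone,
    add_sub_add_comm, ← mul_sub, ← Finset.sum_sub_distrib]
  congr 2
  refine Finset.sum_congr rfl fun j hj => ?_
  rw [Finset.mem_Ico] at hj
  rw [Nat.cast_sub (by omega)]
  push_cast
  simp only [one_pow]
  ring

/-! ### Splitting over `j`, and convergence for `j < r`. -/

theorem psi_natCast {r : ℕ} (hr : 1 ≤ r) :
    psi r = harm (r - 1) - Real.eulerMascheroniConstant := by
  obtain ⟨R, rfl⟩ := Nat.exists_eq_add_of_le' hr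
  rw [Nat.add_sub_cancel, ← psi_nat_add_one, Nat.cast_succ]

theorem harm_nonneg (n : ℕ) : 0 ≤ harm n := by
  simp only [harm, harmonic]
  positivity

/-- Any growth below the first power suffices for summability; the constant is `1 + 2(r+1)`, from
`log m ≤ 2√m`. -/
theorem harm_add_le (r i : ℕ) : harm (r + i) ≤ (2 * r + 3) * ((i : ℝ) + 1) ^ (1 / 2 : ℝ) := by
  have hi : (0 : ℝ) ≤ i := i.cast_nonneg
  have hr : (0 : ℝ) ≤ r := r.cast_nonneg
  have h1 : harm (r + i) ≤ 1 + Real.log (r + i : ℕ) := harmonic_le_one_add_log _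
  have h2 := Real.log_le_rpow_div (x := (r + i : ℕ)) (Nat.cast_nonneg _) (ε := 1 / 2) (by norm_num)
  have h3 : ((r + i : ℕ) : ℝ) ^ (1 / 2 : ℝ) ≤ (r + 1) * ((i : ℝ) + 1) ^ (1 / 2 : ℝ) := by
    calc ((r + i : ℕ) : ℝ) ^ (1 / 2 : ℝ) ≤ (((r : ℝ) + 1) * (i + 1)) ^ (1 / 2 : ℝ) := by
          gcongr
          push_cast
          nlinarith
      _ = ((r : ℝ) + 1) ^ (1 / 2 : ℝ) * ((i : ℝ) + 1) ^ (1 / 2 : ℝ) :=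
          Real.mul_rpow (by positivity) (by positivity)
      _ ≤ _ := by
          gcongr
          calc ((r : ℝ) + 1) ^ (1 / 2 : ℝ) ≤ ((r : ℝ) + 1) ^ (1 : ℝ) :=
                Real.rpow_le_rpow_of_exponent_le (by linarith) (by norm_num)
            _ = _ := Real.rpow_one _
  have h4 : 1 ≤ ((i : ℝ) + 1) ^ (1 / 2 : ℝ) := Real.one_le_rpow (by linarith) (by norm_num)
  rw [div_eq_mul_inv, show ((1 : ℝ) / 2)⁻¹ = 2 by norm_num] at h2
  linarith

theorem summable_eTerm {r j : ℕ} (hj : j < r) : Summable (eTerm r j) := by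
  -- The exponent `-3/2` is `1/2 - 2`: square-root growth over a power at least 2, as `j < r`.
  have hs : Summable fun i : ℕ => (2 * r + 3) * ((i + 1 : ℕ) : ℝ) ^ (-3 / 2 : ℝ) :=
    ((summable_nat_add_iff 1).2 (Real.summable_nat_rpow.2 (by norm_num))).mul_left _
  refine hs.of_nonneg_of_le (fun i => div_nonneg (harm_nonneg _) (by positivity)) fun i => ?_
  have h0 : (0 : ℝ) < (i : ℝ) + 1 := by positivity
  rw [eTerm, div_le_iff₀ (by positivity)]
  calc harm (r + i) ≤ (2 * r + 3) * ((i : ℝ) + 1) ^ (1 / 2 : ℝ) := harm_add_le r i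
    _ = (2 * r + 3) * ((i + 1 : ℕ) : ℝ) ^ (-3 / 2 : ℝ) * ((i : ℝ) + 1) ^ 2 := by
        push_cast
        rw [mul_assoc, ← Real.rpow_natCast _ 2, ← Real.rpow_add h0]
        norm_num
    _ ≤ _ := by
        gcongr
        · linarith [(Nat.cast_nonneg i : (0 : ℝ) ≤ i)]
        · omega

theorem continuousOn_psi_add_one_div_pow (m : ℕ) :
    ContinuousOn (fun x : ℝ => psi (x + 1) / x ^ m) (Set.Ioi 0) :=
  continuousOn_psi_add_one.div (by fun_prop) fun x hx => pow_ne_zero _ (ne_of_gt hx)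

theorem integrableOn_eIntegrand {r j : ℕ} (hj : j < r) :
    IntegrableOn (eIntegrand r j) (Set.Ioi 1) := by
  have hs := (integrableOn_Ioi_rpow_of_lt (by norm_num : (-3 / 2 : ℝ) < -1) one_pos).const_mul 3
  refine Integrable.mono' hs (((continuousOn_psi_add_one_div_pow _).mono
    (Set.Ioi_subset_Ioi zero_le_one)).aestronglyMeasurable measurableSet_Ioi) ?_
  refine ae_restrict_of_forall_mem measurableSet_Ioi fun x hx => ?_
  have hx : 1 < x := hx
  have h0 : 0 < x := by linarith
  have h1 := psi_add_one_le h0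
  have h2 := log_le_psi_add_one h0
  have h3 := Real.log_nonneg hx.le
  have h4 := Real.log_le_rpow_div h0.le (ε := 1 / 2) (by norm_num)
  rw [div_eq_mul_inv, show ((1 : ℝ) / 2)⁻¹ = 2 by norm_num] at h4
  have h5 : 1 ≤ x ^ (1 / 2 : ℝ) := Real.one_le_rpow hx.le (by norm_num)
  have h6 : 1 / x ≤ 1 := by rw [div_le_one h0]; exact hx.le
  rw [eIntegrand, Real.norm_of_nonneg (div_nonneg (h3.trans h2) (by positivity)), div_le_iff₀ (by positivity)]
  calc psi (x + 1) ≤ 3 * x ^ (1 / 2 : ℝ) := by linarith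
    _ = 3 * x ^ (-3 / 2 : ℝ) * x ^ 2 := by
        rw [mul_assoc, ← Real.rpow_natCast _ 2, ← Real.rpow_add h0]
        norm_num
    _ ≤ _ := by
        gcongr
        · exact hx.le
        · omega

theorem hasSum_zetaNat {m : ℕ} (hm : 1 < m) :
    HasSum (fun i : ℕ => 1 / ((i : ℝ) + 1) ^ m) (zetaNat m) := by
  have h0 : Summable fun n : ℕ => 1 / (n : ℝ) ^ m := Real.summable_one_div_nat_pow.2 hm
  have h1 : zetaNat m = ∑' n : ℕ, 1 / (n : ℝ) ^ m := by
    rw [zetaNat, zeta_nat_eq_tsum_of_gt_one hm]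
    have : ∑' n : ℕ, 1 / (n : ℂ) ^ m = ((∑' n : ℕ, 1 / (n : ℝ) ^ m : ℝ) : ℂ) := by
      push_cast
      rfl
    rw [this, Complex.ofReal_re]
  rw [h1, h0.tsum_eq_zero_add]
  have h2 := ((summable_nat_add_iff 1).2 h0).hasSum
  push_cast at h2 ⊢
  -- The term at `0` is `1/0 = 0` by convention.
  rwa [zero_pow (by omega), div_zero, zero_add]

/-- The part of `Γ(r) y_n(r)` with the exponent `r + 1 - j`, without its Stirling number. -/
noncomputable def stirlingPart (r j n : ℕ) : ℝ :=
  (∑ k ∈ Finset.Icc 1 n, (harm (k + r - 1) - harm (r - 1)) / (k : ℝ) ^ (r + 1 - j))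
    - (∫ x in (1 : ℝ)..(n : ℝ), psi (x + 1) / x ^ (r + 1 - j))
    + psi r * ∫ x in (1 : ℝ)..(n : ℝ), 1 / x ^ (r + 1 - j)

/-- An exact identity for each `n`; only the limits of its separate pieces remain afterwards. -/
theorem Gamma_mul_ySeq {r n : ℕ} (hr : 1 ≤ r) (hn : 1 ≤ n) :
    Real.Gamma r * ySeq r n =
      ∑ j ∈ Finset.Ico 1 (r + 1), (Nat.stirlingFirst r j : ℝ) * stirlingPart r j n
        - (stirlingLaurent r n - r.factorial + r * ∑ j ∈ Finset.Ico 1 (r + 1),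
          (Nat.stirlingFirst r j : ℝ) *
            ((1 - 1 / (n : ℝ) ^ (r + 1 - j)) / ((r : ℝ) + 1 - j))) := by
  have hn' : (1 : ℝ) ≤ n := by exact_mod_cast hn
  have hsub : Set.uIcc (1 : ℝ) n ⊆ Set.Ioi 0 := by
    rw [Set.uIcc_of_le hn']
    exact fun x hx => zero_lt_one.trans_le hx.1
  have hsum : Real.Gamma r * ∑ k ∈ Finset.Icc 1 n, hyperharmonic r k / (k : ℝ) ^ r =
      ∑ j ∈ Finset.Ico 1 (r + 1), (Nat.stirlingFirst r j : ℝ) *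
        ∑ k ∈ Finset.Icc 1 n, (harm (k + r - 1) - harm (r - 1)) / (k : ℝ) ^ (r + 1 - j) := by
    simp_rw [Finset.mul_sum]
    rw [Finset.sum_comm]
    refine Finset.sum_congr rfl fun k hk => ?_
    rw [Gamma_mul_hyperharmonic_div hr (Finset.mem_Icc.1 hk).1, stirlingLaurent, Finset.sum_mul]
    exact Finset.sum_congr rfl fun j _ => by ring
  have hc1 (j : ℕ) : IntervalIntegrable (fun x : ℝ => psi (x + 1) / x ^ (r + 1 - j)) volume 1 n :=
    ((continuousOn_psi_add_one_div_pow _).mono hsub).intervalIntegrable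
  have hc2 (j : ℕ) : IntervalIntegrable (fun x : ℝ => 1 / x ^ (r + 1 - j)) volume 1 n :=
    (ContinuousOn.div (by fun_prop) (by fun_prop)
      fun x hx => pow_ne_zero _ (ne_of_gt (hsub hx))).intervalIntegrable
  have hc3 : IntervalIntegrable
      (fun x => stirlingLaurent r x * ∑ i ∈ Finset.Ico 1 r, 1 / (x + i)) volume 1 n := by
    refine ContinuousOn.intervalIntegrable fun x hx => ?_
    have hx : 0 < x := hsub hx
    refine ((hasDerivAt_stirlingLaurent hr hx).continuousAt.mul ?_).continuousWithinAt
    refine tendsto_finsetSum _ fun i _ => ?_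
    have : x + i ≠ 0 := by positivity
    exact ContinuousAt.tendsto (f := fun x : ℝ => 1 / (x + i)) (by fun_prop (disch := simp [this]))
  have hint : Real.Gamma r * ∫ x in (1 : ℝ)..(n : ℝ), hyperharmonicExt r x / x ^ r =
      ∑ j ∈ Finset.Ico 1 (r + 1), (Nat.stirlingFirst r j : ℝ) *
        ((∫ x in (1 : ℝ)..(n : ℝ), psi (x + 1) / x ^ (r + 1 - j)) -
          psi r * ∫ x in (1 : ℝ)..(n : ℝ), 1 / x ^ (r + 1 - j)) +
        ∫ x in (1 : ℝ)..(n : ℝ), stirlingLaurent r x * ∑ i ∈ Finset.Ico 1 r, 1 / (x + i) := by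
    have heq : ∫ x in (1 : ℝ)..(n : ℝ), Real.Gamma r * (hyperharmonicExt r x / x ^ r) =
        ∫ x in (1 : ℝ)..(n : ℝ), (∑ j ∈ Finset.Ico 1 (r + 1), (Nat.stirlingFirst r j : ℝ) *
          (psi (x + 1) / x ^ (r + 1 - j) - psi r * (1 / x ^ (r + 1 - j)))) +
          stirlingLaurent r x * ∑ i ∈ Finset.Ico 1 r, 1 / (x + i) := by
      refine intervalIntegral.integral_congr fun x hx => ?_
      have hx : 0 < x := hsub hx
      have h1 : ∑ j ∈ Finset.Ico 1 (r + 1), (Nat.stirlingFirst r j : ℝ) *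
          (psi (x + 1) / x ^ (r + 1 - j) - psi r * (1 / x ^ (r + 1 - j))) =
          stirlingLaurent r x * (psi (x + 1) - psi r) := by
        rw [stirlingLaurent, Finset.sum_mul]
        exact Finset.sum_congr rfl fun j _ => by ring
      simp only [Gamma_mul_hyperharmonicExt_div hr hx, psi_add_nat hx hr, h1]
      ring
    rw [← intervalIntegral.integral_const_mul, heq, intervalIntegral.integral_add _ hc3,
      intervalIntegral.integral_finsetSum]
    · congr 1
      refine Finset.sum_congr rfl fun j _ => ?_
      rw [intervalIntegral.integral_const_mul,
        intervalIntegral.integral_sub (hc1 j) ((hc2 j).const_mul _),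
        intervalIntegral.integral_const_mul]
    · exact fun j _ => ((hc1 j).sub ((hc2 j).const_mul _)).const_mul _
    · have := IntervalIntegrable.sum (Finset.Ico 1 (r + 1)) fun j _ =>
        ((hc1 j).sub ((hc2 j).const_mul (psi r))).const_mul (Nat.stirlingFirst r j : ℝ)
      rwa [Finset.sum_fn] at this
  rw [ySeq, mul_sub, hsum, hint, integral_stirlingLaurent_mul_sum hr hn', ← sub_sub,
    ← Finset.sum_sub_distrib]
  congr 1
  refine Finset.sum_congr rfl fun j _ => ?_
  rw [stirlingPart]
  ring

theorem tendsto_one_div_natCast_pow {p : ℕ} (hp : p ≠ 0) :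
    Tendsto (fun n : ℕ => 1 / (n : ℝ) ^ p) atTop (𝓝 0) :=
  tendsto_const_nhds.div_atTop ((tendsto_pow_atTop hp).comp tendsto_natCast_atTop_atTop)

theorem tendsto_stirlingPart {r j : ℕ} (hj : j < r) :
    Tendsto (stirlingPart r j) atTop
      (𝓝 (eConst r j - harm (r - 1) * zetaNat (r + 1 - j) + psi r / ((r : ℝ) - j))) := by
  have h1 := (summable_eTerm hj).hasSum.tendsto_sum_nat
  have h2 := ((hasSum_zetaNat (m := r + 1 - j) (by omega)).mul_left
    (harm (r - 1))).tendsto_sum_nat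
  have h3 := intervalIntegral_tendsto_integral_Ioi 1 (integrableOn_eIntegrand hj)
    tendsto_natCast_atTop_atTop
  have hp : r - j ≠ 0 := by omega
  have h4 : Tendsto (fun n : ℕ => psi r * ((1 - 1 / (n : ℝ) ^ (r - j)) / (r - j : ℕ))) atTop
      (𝓝 (psi r * ((1 - 0) / (r - j : ℕ)))) :=
    (((tendsto_one_div_natCast_pow hp).const_sub 1).div_const _).const_mul _
  have h := ((h1.sub h2).sub h3).add h4
  have hlim : eConst r j - harm (r - 1) * zetaNat (r + 1 - j) + psi r / ((r : ℝ) - j) =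
      (∑' i, eTerm r j i) - harm (r - 1) * zetaNat (r + 1 - j) -
        (∫ x in Set.Ioi (1 : ℝ), eIntegrand r j x) + psi r * ((1 - 0) / (r - j : ℕ)) := by
    rw [eConst, Nat.cast_sub hj.le]
    ring
  rw [hlim]
  refine h.congr' ?_
  filter_upwards [eventually_ge_atTop 1] with n hn
  have hn' : (1 : ℝ) ≤ n := by exact_mod_cast hn
  have he : r + 1 - j = r - j + 1 := by omega
  rw [stirlingPart, sum_Icc_one_eq_sum_range, ← Finset.sum_sub_distrib]
  congr 1
  · congr 1
    refine Finset.sum_congr rfl fun i _ => ?_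
    rw [eTerm, show i + 1 + r - 1 = r + i by omega]
    push_cast
    ring
  · rw [he, integral_inv_pow hn' hp]

/-! ### The critical exponent `j = r`. -/

theorem tendsto_harm_add_sub_harm (i : ℕ) :
    Tendsto (fun n : ℕ => harm (n + i) - harm n) atTop (𝓝 0) := by
  induction i with
  | zero => simp
  | succ i ih =>
    have h1 : Tendsto (fun n : ℕ => 1 / ((n + i : ℕ) + 1 : ℝ)) atTop (𝓝 0) :=
      (tendsto_one_div_add_atTop_nhds_zero_nat (𝕜 := ℝ)).comp (tendsto_add_atTop_nat i)
    have h2 := ih.add h1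
    rw [add_zero] at h2
    refine h2.congr fun n => ?_
    rw [← add_assoc n i 1, harm_succ (n + i)]
    ring

/-- Telescoping gives the partial sum `(H_i - (H_{n+i} - H_n))/i`. -/
theorem tendsto_sum_one_div_mul_add {i : ℕ} (hi : 1 ≤ i) :
    Tendsto (fun n : ℕ => ∑ k ∈ Finset.Icc 1 n, 1 / ((k : ℝ) * (k + i))) atTop
      (𝓝 (harm i / i)) := by
  have hi0 : (i : ℝ) ≠ 0 := by positivity
  have h := ((tendsto_harm_add_sub_harm i).const_sub (harm i)).div_const (i : ℝ)
  rw [sub_zero] at h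
  refine h.congr fun n => ?_
  induction n with
  | zero => simp [harm]
  | succ n ih =>
    rw [Finset.sum_Icc_succ_top (by omega), ← ih, show n + 1 + i = n + i + 1 by ring,
      harm_succ (n + i), harm_succ n]
    push_cast
    field_simp
    ring

theorem sum_harm_div (n : ℕ) :
    ∑ k ∈ Finset.Icc 1 n, harm k / k =
      (harm n ^ 2 + ∑ i ∈ Finset.range n, 1 / ((i : ℝ) + 1) ^ 2) / 2 := by
  rw [sum_Icc_one_eq_sum_range]
  induction n with
  | zero => simp [harm]
  | succ n ih =>
    rw [Finset.sum_range_succ, Finset.sum_range_succ, ih, harm_succ]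
    push_cast
    field_simp
    ring

theorem tendsto_harm_sub_log :
    Tendsto (fun n : ℕ => harm n - Real.log n) atTop (𝓝 Real.eulerMascheroniConstant) :=
  Real.tendsto_harmonic_sub_log

/-- Removes the last divergence of the case `j = r`: the error in `H_n - ln n → γ` is at most `1/n`,
which beats `ln n`. -/
theorem tendsto_harm_sub_log_sub_mul_log :
    Tendsto (fun n : ℕ => (harm n - Real.log n - Real.eulerMascheroniConstant) * Real.log n) atTop
      (𝓝 0) := by
  have hl : Tendsto (fun n : ℕ => Real.log n / (n : ℝ)) atTop (𝓝 0) := by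
    have := Real.isLittleO_log_id_atTop.tendsto_div_nhds_zero
    exact this.comp tendsto_natCast_atTop_atTop
  have hb (n : ℕ) (hn : 1 ≤ n) : 0 ≤ Real.log n ∧
      Real.log n ≤ harm n - Real.eulerMascheroniConstant ∧
      harm n - Real.eulerMascheroniConstant ≤ Real.log n + 1 / n := by
    have hn' : (0 : ℝ) < n := by exact_mod_cast hn
    rw [← psi_nat_add_one]
    exact ⟨Real.log_natCast_nonneg n, log_le_psi_add_one hn', psi_add_one_le hn'⟩
  refine squeeze_zero' ?_ ?_ hl
  · filter_upwards [eventually_ge_atTop 1] with n hn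
    obtain ⟨h0, h1, h2⟩ := hb n hn
    exact mul_nonneg (by linarith) h0
  · filter_upwards [eventually_ge_atTop 1] with n hn
    obtain ⟨h0, h1, h2⟩ := hb n hn
    calc _ ≤ 1 / (n : ℝ) * Real.log n := by
          gcongr
          linarith
      _ = _ := by ring

/-- Write `H_n² - ln²n = (H_n - ln n)² + 2(H_n - ln n) ln n`. Since `ψ(r) = H_{r-1} - γ`, the term
`ψ(r) ln n` supplies the `-γ ln n` needed to compensate the cross term, and its other part turns
`H_{r-1} H_n` into `H_{r-1}(H_n - ln n)`. -/
theorem tendsto_stirlingPart_self {r : ℕ} (hr : 1 ≤ r) :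
    Tendsto (stirlingPart r r) atTop
      (𝓝 (1 / 2 * Real.eulerMascheroniConstant ^ 2 + 1 / 2 * zetaNat 2 - 1 / 2
          + (∫ t in Set.Ioi (0 : ℝ), logIntegrand t)
          - (psi r + Real.eulerMascheroniConstant) * Real.eulerMascheroniConstant
          + ∑ j ∈ Finset.Ico 1 r, harm j / (j : ℝ))) := by
  have h1 := (tendsto_harm_sub_log.pow 2).div_const 2
  have h2 := tendsto_harm_sub_log_sub_mul_log
  have h3 := (hasSum_zetaNat one_lt_two).tendsto_sum_nat.div_const 2
  have h4 : Tendsto (fun n : ℕ => ∑ i ∈ Finset.Ico 1 r, ∑ k ∈ Finset.Icc 1 n,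
      1 / ((k : ℝ) * (k + i))) atTop (𝓝 (∑ i ∈ Finset.Ico 1 r, harm i / (i : ℝ))) :=
    tendsto_finsetSum _ fun i hi => tendsto_sum_one_div_mul_add (Finset.mem_Ico.1 hi).1
  have h5 := tendsto_harm_sub_log.const_mul (harm (r - 1))
  have h6 := tendsto_integral_psi_add_one_div
  have h := ((((h1.add h2).add h3).add h4).sub h5).sub h6
  have hpsi := psi_natCast hr
  refine (h.congr' ?_).trans_eq ?_
  · filter_upwards [eventually_ge_atTop 1] with n hn
    have hn' : (1 : ℝ) ≤ n := by exact_mod_cast hn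
    have e1 : ∑ k ∈ Finset.Icc 1 n, (harm (k + r - 1) - harm (r - 1)) / (k : ℝ) ^ 1 =
        ∑ k ∈ Finset.Icc 1 n, harm k / k +
          ∑ i ∈ Finset.Ico 1 r, ∑ k ∈ Finset.Icc 1 n, 1 / ((k : ℝ) * (k + i)) -
          harm (r - 1) * harm n := by
      have e2 : harm n = ∑ k ∈ Finset.Icc 1 n, 1 / (k : ℝ) := by
        rw [sum_Icc_one_eq_sum_range]
        simp [harm, harmonic]
      rw [e2, Finset.sum_comm, Finset.mul_sum, ← Finset.sum_add_distrib, ← Finset.sum_sub_distrib]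
      refine Finset.sum_congr rfl fun k hk => ?_
      have hk : 1 ≤ k := (Finset.mem_Icc.1 hk).1
      have hk0 : (0 : ℝ) < k := by exact_mod_cast hk
      have h7 := psi_add_nat hk0 hr
      rw [psi_nat_add_one, ← Nat.cast_add, psi_natCast (by omega)] at h7
      have h8 : harm (k + r - 1) = harm k + ∑ i ∈ Finset.Ico 1 r, 1 / ((k : ℝ) + i) := by linarith
      have h9 : ∑ i ∈ Finset.Ico 1 r, 1 / ((k : ℝ) * (k + i)) =
          (∑ i ∈ Finset.Ico 1 r, 1 / ((k : ℝ) + i)) / k := by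
        rw [Finset.sum_div]
        exact Finset.sum_congr rfl fun i _ => by field_simp
      rw [h8, h9]
      ring
    have e3 : ∫ x in (1 : ℝ)..n, 1 / x ^ 1 = Real.log n := by
      simp only [pow_one]
      rw [integral_one_div_of_pos one_pos (by linarith), div_one]
    rw [stirlingPart, Nat.add_sub_cancel_left, e1, e3, sum_harm_div, hpsi]
    ring
  · congr 1
    rw [hpsi]
    ring

/-! ### Assembly for positive `r`. -/

theorem tendsto_Gamma_mul_ySeq {r : ℕ} (hr : 1 ≤ r) :
    Tendsto (fun n => Real.Gamma r * ySeq r n) atTop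
      (𝓝 (1 / 2 * Real.eulerMascheroniConstant ^ 2 + 1 / 2 * zetaNat 2 - 1 / 2
          + (∫ t in Set.Ioi (0 : ℝ), logIntegrand t)
          - (psi r + Real.eulerMascheroniConstant) * Real.eulerMascheroniConstant
          + (r.factorial : ℝ) - (r : ℝ)
          + (∑ j ∈ Finset.Ico 1 r, harm j / (j : ℝ))
          + ∑ j ∈ Finset.Ico 1 r, (Nat.stirlingFirst r j : ℝ) *
              (eConst r j + psi r / ((r : ℝ) - j) - (r : ℝ) / ((r : ℝ) + 1 - j)
                - harm (r - 1) * zetaNat (r + 1 - j)))) := by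
  have h1 : Tendsto (fun n => ∑ j ∈ Finset.Ico 1 r,
      (Nat.stirlingFirst r j : ℝ) * stirlingPart r j n) atTop _ :=
    tendsto_finsetSum _ fun j hj => (tendsto_stirlingPart (Finset.mem_Ico.1 hj).2).const_mul _
  have h2 := tendsto_stirlingPart_self hr
  have h3 : Tendsto (fun n : ℕ => stirlingLaurent r n) atTop
      (𝓝 (∑ j ∈ Finset.Ico 1 (r + 1), (Nat.stirlingFirst r j : ℝ) * 0)) := by
    refine tendsto_finsetSum _ fun j hj => ?_
    have := (tendsto_one_div_natCast_pow (p := r + 1 - j)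
      (by have := Finset.mem_Ico.1 hj; omega)).const_mul (Nat.stirlingFirst r j : ℝ)
    exact this.congr fun n => mul_one_div _ _
  have h4 : Tendsto (fun n : ℕ => ∑ j ∈ Finset.Ico 1 (r + 1), (Nat.stirlingFirst r j : ℝ) *
      ((1 - 1 / (n : ℝ) ^ (r + 1 - j)) / ((r : ℝ) + 1 - j))) atTop
      (𝓝 (∑ j ∈ Finset.Ico 1 (r + 1), (Nat.stirlingFirst r j : ℝ) *
        ((1 - 0) / ((r : ℝ) + 1 - j)))) := by
    refine tendsto_finsetSum _ fun j hj => ?_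
    exact (((tendsto_one_div_natCast_pow (p := r + 1 - j)
      (by have := Finset.mem_Ico.1 hj; omega)).const_sub 1).div_const _).const_mul _
  have h := (h1.add h2).sub ((h3.sub_const (r.factorial : ℝ)).add (h4.const_mul (r : ℝ)))
  refine (h.congr' ?_).trans_eq ?_
  · filter_upwards [eventually_ge_atTop 1] with n hn
    rw [Gamma_mul_ySeq hr hn]
    congr 1
    rw [Finset.sum_Ico_succ_top hr, Nat.stirlingFirst_self, Nat.cast_one, one_mul]
  · congr 1
    have e1 : ∑ j ∈ Finset.Ico 1 r, (Nat.stirlingFirst r j : ℝ) *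
        (eConst r j + psi r / ((r : ℝ) - j) - (r : ℝ) / ((r : ℝ) + 1 - j)
          - harm (r - 1) * zetaNat (r + 1 - j)) =
        ∑ j ∈ Finset.Ico 1 r, (Nat.stirlingFirst r j : ℝ) *
          (eConst r j - harm (r - 1) * zetaNat (r + 1 - j) + psi r / ((r : ℝ) - j)) -
        r * ∑ j ∈ Finset.Ico 1 r, (Nat.stirlingFirst r j : ℝ) * ((1 - 0) / ((r : ℝ) + 1 - j)) := by
      rw [Finset.mul_sum, ← Finset.sum_sub_distrib]
      exact Finset.sum_congr rfl fun j _ => by ring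
    -- The index `j = r` contributes `1`, the source of the lone `-r` in the formula.
    have e2 : ∑ j ∈ Finset.Ico 1 (r + 1), (Nat.stirlingFirst r j : ℝ) *
        ((1 - 0) / ((r : ℝ) + 1 - j)) = ∑ j ∈ Finset.Ico 1 r, (Nat.stirlingFirst r j : ℝ) *
          ((1 - 0) / ((r : ℝ) + 1 - j)) + 1 := by
      rw [Finset.sum_Ico_succ_top hr, Nat.stirlingFirst_self]
      simp
    rw [e1, e2]
    simp only [mul_zero, Finset.sum_const_zero]
    ring

/-! ### The case `r = 0` and the conclusion. -/

theorem ySeq_zero {n : ℕ} (hn : 1 ≤ n) : ySeq 0 n = harm n - Real.log n := by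
  have hn' : (0 : ℝ) < n := by exact_mod_cast hn
  simp only [ySeq, hyperharmonic, hyperharmonicExt, if_true, pow_zero, div_one]
  rw [integral_one_div_of_pos one_pos hn', div_one, sum_Icc_one_eq_sum_range]
  simp [harm, harmonic]

theorem tendsto_ySeq_zero : Tendsto (ySeq 0) atTop (𝓝 Real.eulerMascheroniConstant) :=
  tendsto_harm_sub_log.congr' ((eventually_ge_atTop 1).mono fun _ hn => (ySeq_zero hn).symm)

/-- `limUnder` carries information only once some limit is exhibited, which the two cases do. -/
theorem tendsto_ySeq_gammaH (r : ℕ) : Tendsto (ySeq r) atTop (𝓝 (gammaH r)) := by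
  refine tendsto_nhds_limUnder ?_
  obtain rfl | hr := Nat.eq_zero_or_pos r
  · exact ⟨_, tendsto_ySeq_zero⟩
  · have hG : Real.Gamma r ≠ 0 := (Real.Gamma_pos_of_pos (by exact_mod_cast hr)).ne'
    refine ⟨_, ((tendsto_Gamma_mul_ySeq hr).const_mul (Real.Gamma r)⁻¹).congr fun n => ?_⟩
    rw [inv_mul_cancel_left₀ hG]

/-- `ψ / Γ` tends to `-1` at their common pole `0`, and `1 / Γ` tends to `0`. -/
theorem tendsto_add_psi_div_Gamma (a b c : ℝ) :
    Tendsto (fun s : ℝ => (a - (psi s + b) * c + Real.Gamma (s + 1) - s) / Real.Gamma s)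
      (𝓝[≠] 0) (𝓝 c) := by
  have h1 : ContinuousAt (fun s : ℝ => psi (s + 1)) 0 := by
    refine ContinuousAt.comp (g := psi) (f := fun s : ℝ => s + 1) ?_ (by fun_prop)
    exact continuousOn_psi.continuousAt (Ioi_mem_nhds (by norm_num))
  have h2 : ContinuousAt (fun s : ℝ => Real.Gamma (s + 1)) 0 := by
    refine ContinuousAt.comp (g := Real.Gamma) (f := fun s : ℝ => s + 1) ?_ (by fun_prop)
    exact (Real.differentiableAt_Gamma_of_pos (by norm_num)).continuousAt
  have hG : Real.Gamma (0 + 1) ≠ 0 := by simp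
  -- This is the same quotient with the pole removed: `1/Γ(s) = s/Γ(s+1)` and `sψ(s) = sψ(s+1) - 1`,
  -- whence the extra `+ c`.
  have h3 : ContinuousAt (fun s : ℝ =>
      (s * (a - (psi (s + 1) + b) * c + Real.Gamma (s + 1) - s) + c) / Real.Gamma (s + 1)) 0 := by
    refine ContinuousAt.div ?_ h2 hG
    fun_prop
  have h4 := h3.tendsto.mono_left (nhdsWithin_le_nhds (s := {0}ᶜ))
  simp only [zero_mul, zero_add, Real.Gamma_one, div_one] at h4
  refine h4.congr' ?_
  -- The punctured interval `(-1, 1)` avoids every pole of `Γ`.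
  have hmem : Set.Ioo (-1 : ℝ) 1 ∈ 𝓝[≠] (0 : ℝ) :=
    mem_nhdsWithin_of_mem_nhds (Ioo_mem_nhds (by norm_num) (by norm_num))
  filter_upwards [hmem, self_mem_nhdsWithin] with s hs hs0
  have hs0 : s ≠ 0 := hs0
  have hm : ∀ m : ℕ, s ≠ -m := by
    rintro (_ | m) rfl
    · simp at hs0
    · have := hs.1
      push_cast at this
      linarith [(Nat.cast_nonneg m : (0 : ℝ) ≤ m)]
  have hGs : Real.Gamma s ≠ 0 := Real.Gamma_ne_zero hm
  rw [psi_add_one hm, Real.Gamma_add_one hs0]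
  field_simp
  ring

theorem mainTheorem3 (r : ℕ) :
    -- the limit, the improper integrals and the series in the statement all converge
    Tendsto (ySeq r) atTop (𝓝 (gammaH r)) ∧
    IntegrableOn logIntegrand (Set.Ioi 0) ∧
    (∀ j ∈ Finset.Ico 1 r,
      Summable (eTerm r j) ∧ IntegrableOn (eIntegrand r j) (Set.Ioi 1)) ∧
    -- the closed form for positive `r`
    (1 ≤ r →
      Real.Gamma r * gammaH r =
        1 / 2 * Real.eulerMascheroniConstant ^ 2 + 1 / 2 * zetaNat 2 - 1 / 2
          + (∫ t in Set.Ioi (0 : ℝ), logIntegrand t)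
          - (psi r + Real.eulerMascheroniConstant) * Real.eulerMascheroniConstant
          + (r.factorial : ℝ) - (r : ℝ)
          + (∑ j ∈ Finset.Ico 1 r, harm j / (j : ℝ))
          + ∑ j ∈ Finset.Ico 1 r, (Nat.stirlingFirst r j : ℝ) *
              (eConst r j + psi r / ((r : ℝ) - j) - (r : ℝ) / ((r : ℝ) + 1 - j)
                - harm (r - 1) * zetaNat (r + 1 - j))) ∧
    -- for `r = 0` the sums are empty, `Γ` and `ψ` have poles, and the formula, divided by
    -- `Γ(r)`, is read as a limit; its value is Euler's constant
    (r = 0 →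
      Tendsto (fun s : ℝ =>
          (1 / 2 * Real.eulerMascheroniConstant ^ 2 + 1 / 2 * zetaNat 2 - 1 / 2
            + (∫ t in Set.Ioi (0 : ℝ), logIntegrand t)
            - (psi s + Real.eulerMascheroniConstant) * Real.eulerMascheroniConstant
            + Real.Gamma (s + 1) - s) / Real.Gamma s)
        (𝓝[≠] 0) (𝓝 (gammaH 0)) ∧
      gammaH 0 = Real.eulerMascheroniConstant) := by
  have hlim := tendsto_ySeq_gammaH r
  refine ⟨hlim, integrableOn_binetIntegral_div.2.1, fun j hj => ?_, fun hr => ?_, ?_⟩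
  · have hj := (Finset.mem_Ico.1 hj).2
    exact ⟨summable_eTerm hj, integrableOn_eIntegrand hj⟩
  · exact tendsto_nhds_unique (hlim.const_mul _) (tendsto_Gamma_mul_ySeq hr)
  · rintro rfl
    have h0 := tendsto_nhds_unique hlim tendsto_ySeq_zero
    rw [h0]
    exact ⟨tendsto_add_psi_div_Gamma _ _ _, rfl⟩
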